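/- \textbf{Corollary (Bounded-rank-width circuits with growing competing parameters).} \emph{Graph parameters.} Graphs are finite and simple. $\operatorname{tw}(G)$ is the treewidth of $G$. For $X\subseteq V(G)$ let $\rho_G(X)$ be the rank over $\mathbb F_2$ of the submatrix of the adjacency matrix of $G$ with rows $X$ and columns $V(G)\setminus X$. The rank-width $\operatorname{rw}(G)$ is the minimum, over all trees $T$ of maximum degree at most $3$ with a bijection between the leaves of $T$ and $V(G)$, of the maximum over the edges $e$ of $T$ of $\rho_G(X_e)$, where $X_e$ is the set of vertices of $G$ on one side of $T-e$ (and $\operatorname{rw}(G)=0$ if $|V(G)|\le 1$). The linear rank-width $\operatorname{lrw}(G)$ is the minimum over all orderings $v_1,\dots,v_m$ of $V(G)$ of $\max_{1\le i<m}\rho_G(\{v_1,\dots,v_i\})$ (and $0$ if $m\le 1$). \emph{SOP variable graph.} Let $C$ be a circuit (a finite sequence of gates) on $n$ qubits over $\{\mathrm H,\mathrm T,\mathrm{CZ}\}$, and let $y,z\in\{0,1\}^n$. Cut the wire of each qubit $a$ at its $k_a$ Hadamard gates into segments carrying variables $x_{a,0},\dots,x_{a,k_a}$. Let $f$ be the polynomial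 over $\mathbb Z/8$ which is the sum, over all gates, of $4x_sx_{s'}$ for each $\mathrm H$ leading from segment $s$ to its successor $s'$, of $4x_sx_t$ for each $\mathrm{CZ}$ touching the segments $s,t$, and of $x_s$ for each $\mathrm T$ on segment $s$. Substitute $x_{a,0}=y_a$ and $x_{a,k_a}=z_a$ for all $a$. The SOP variable graph $G_C$ of the amplitude $\langle z|C|y\rangle$ has as vertices the remaining (free) variables, and $u,v$ are adjacent if and only if the monomial $uv$ has a nonzero coefficient modulo $8$ in the resulting polynomial. (On a wire without Hadamard gates, $x_{a,0}=x_{a,k_a}$ is a single pinned variable; in every case the graph $G_C$ does not depend on the values $y,z$.) \emph{Contraction complexity.} The tensor-network graph $N_C$ is the multigraph with one vertex per gate and one edge for each wire segment joining two consecutive gates on the same wire (input and output legs are not edges). Its line graph $L(N_C)$ has the edges of $N_C$ as vertices, two distinct ones being adjacent when they share an end. Put $\operatorname{cc}(N_C)=\operatorname{tw}(L(N_C))$. \emph{Statement.} There are absolute constants $K\in\mathbb N$ and $c_1,c_2>0$ such that for all integers $h\ge 0$ and $t\ge 1$ there is a circuit $C_{h,t}$ over $\{\mathrm H,\mathrm{CZ}\}$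 with \begin{itemize} \item $\operatorname{rw}(G_{C_{h,t}})\le K$ and $\operatorname{lrw}(G_{C_{h,t}})\ge c_1h$, for all input and output basis states $y,z$, and \item $\operatorname{cc}(N_{C_{h,t}})\ge c_2t$. \end{itemize} -/

import Mathlib

/-! ## Width parameters of finite simple graphs -/

/-- A tree decomposition of `G`, with a finite tree and finite bags. -/
structure TreeDecomposition {V : Type*} (G : SimpleGraph V) where
  Node : Type
  finite_node : Finite Node
  tree : SimpleGraph Node
  isTree : tree.IsTree
  bag : Node → Finset V
  exists_mem_bag : ∀ v, ∃ i, v ∈ bag i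
  exists_edge_bag : ∀ u v, G.Adj u v → ∃ i, u ∈ bag i ∧ v ∈ bag i
  connected_bags : ∀ v, (tree.induce {i | v ∈ bag i}).Connected

/-- Treewidth: the least possible size of a largest bag, minus one. It is an integer since the
graph without vertices has treewidth `-1`. -/
noncomputable def treewidth {V : Type*} (G : SimpleGraph V) : ℤ :=
  (sInf {k : ℕ | ∃ D : TreeDecomposition G, ∀ i, (D.bag i).card ≤ k} : ℕ) - 1

open Classical in
/-- The cut-rank of `X`: the rank over `𝔽₂` of the submatrix of the adjacency matrix of `G` with
rows indexed by `X` and columns indexed by the complement of `X`. -/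
noncomputable def cutRank {V : Type*} [Fintype V] (G : SimpleGraph V) (X : Set V) : ℕ :=
  ((G.adjMatrix (ZMod 2)).submatrix
    (fun u : {v // v ∈ X} => (u : V)) (fun w : {v // v ∉ X} => (w : V))).rank

/-- `x` is a leaf of the tree `T`: it has exactly one neighbour. -/
def IsLeaf {N : Type*} (T : SimpleGraph N) (x : N) : Prop := (T.neighborSet x).ncard = 1

/-- A rank-decomposition with vertex set `V`: a finite tree of maximal degree at most three,
and a bijection between its leaves and `V`. -/
structure RankDecomposition (V : Type*) where
  Node : Type
  finite_node : Finite Node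
  tree : SimpleGraph Node
  isTree : tree.IsTree
  subcubic : ∀ x, (tree.neighborSet x).ncard ≤ 3
  leafEquiv : {x : Node // IsLeaf tree x} ≃ V

/-- The side of the cut of `V` induced by the tree edge `xy` that belongs to the component of `x`
after deletion of this edge. -/
def RankDecomposition.side {V : Type*} (D : RankDecomposition V) (x y : D.Node) : Set V :=
  {v | (D.tree.deleteEdges {s(x, y)}).Reachable x (D.leafEquiv.symm v : D.Node)}

/-- Rank-width: the least width of a rank-decomposition, where the width is the maximum of the
cut-ranks of the cuts induced by the edges of the tree. (A graph with at most one vertex has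
rank-width `0`; every graph with at least two vertices has a rank-decomposition.) -/
noncomputable def rankWidth {V : Type*} [Fintype V] (G : SimpleGraph V) : ℕ :=
  sInf {k : ℕ | ∃ D : RankDecomposition V,
    ∀ x y : D.Node, D.tree.Adj x y → cutRank G (D.side x y) ≤ k}

/-- Linear rank-width: the least width of a linear layout `v₁, …, vₙ`, where the width is the
maximum of the cut-ranks of `{v₁, …, vᵢ}` for `1 ≤ i < n`. -/
noncomputable def linearRankWidth {V : Type*} [Fintype V] (G : SimpleGraph V) : ℕ :=
  sInf {k : ℕ | ∃ π : V ≃ Fin (Fintype.card V),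
    ∀ i : ℕ, 1 ≤ i → i < Fintype.card V → cutRank G {v | (π v : ℕ) < i} ≤ k}

/-- The line graph of a multigraph: its vertices are the edges of `N`, and two distinct edges are
adjacent when they share an end. -/
def multigraphLineGraph {α β : Type*} (N : Graph α β) : SimpleGraph N.edgeSet where
  Adj e f := e ≠ f ∧ ∃ x, N.Inc e x ∧ N.Inc f x
  symm := ⟨fun _ _ h => ⟨h.1.symm, h.2.imp fun _ hx => ⟨hx.2, hx.1⟩⟩⟩
  loopless := ⟨fun _ h => h.1 rfl⟩

/-! ## Circuits -/

/-- The elementary gates on `n` qubits. -/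
inductive Gate (n : ℕ) : Type
  | H (a : Fin n) : Gate n
  | T (a : Fin n) : Gate n
  | CZ (a b : Fin n) (hab : a ≠ b) : Gate n

/-- An `n`-qubit circuit: the list of its gates, in the order in which they are applied. -/
abbrev Circuit (n : ℕ) : Type := List (Gate n)

/-- The qubits on which a gate acts. -/
def Gate.qubits {n : ℕ} : Gate n → Finset (Fin n)
  | .H a => {a}
  | .T a => {a}
  | .CZ a b _ => {a, b}

/-- Is the gate a Hadamard gate on qubit `a`? -/
def Gate.isHadamardOn {n : ℕ} (a : Fin n) : Gate n → Bool
  | .H b => decide (b = a)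
  | _ => false

/-- All gates of the circuit are Hadamard or CZ gates. -/
def Circuit.OverHCZ {n : ℕ} (C : Circuit n) : Prop := ∀ g ∈ C, ∀ a, g ≠ Gate.T a

/-- The number of Hadamard gates on qubit `a`. -/
def hadamardDepth {n : ℕ} (C : Circuit n) (a : Fin n) : ℕ := C.countP (Gate.isHadamardOn a)

/-! ## The sum-of-powers of a circuit amplitude, and its variable graph -/

/-- The segment variables `x_{a,0}, …, x_{a,k_a}` of all wires, where `k_a` is the number of
Hadamard gates on wire `a`. -/
abbrev Segment {n : ℕ} (C : Circuit n) : Type := (a : Fin n) × Fin (hadamardDepth C a + 1)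

/-- The segment of wire `a` that is current after the first `i` gates of the circuit. -/
def segmentAfter {n : ℕ} (C : Circuit n) (i : ℕ) (a : Fin n) : Segment C :=
  ⟨a, hadamardDepth (C.take i) a,
    Nat.lt_succ_of_le ((List.take_sublist i C).countP_le)⟩

open MvPolynomial in
/-- The phase exponent contributed by the gate `g` at (zero-based) position `i`. -/
noncomputable def gatePhase {n : ℕ} (C : Circuit n) (i : ℕ) :
    Gate n → MvPolynomial (Segment C) (ZMod 8)
  | .H a => 4 * X (segmentAfter C i a) * X (segmentAfter C (i + 1) a)
  | .T a => X (segmentAfter C i a)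
  | .CZ a b _ => 4 * X (segmentAfter C i a) * X (segmentAfter C i b)

/-- The raw phase polynomial of the circuit, with coefficients modulo `8`. -/
noncomputable def phasePolynomial {n : ℕ} (C : Circuit n) : MvPolynomial (Segment C) (ZMod 8) :=
  ∑ i : Fin C.length, gatePhase C i (C.get i)

/-- A segment variable is free (not pinned) if it is neither the first nor the last segment of
its wire. -/
def IsFree {n : ℕ} {C : Circuit n} (s : Segment C) : Prop :=
  (s.2 : ℕ) ≠ 0 ∧ (s.2 : ℕ) ≠ hadamardDepth C s.1

/-- The free segment variables. -/
abbrev FreeVar {n : ℕ} (C : Circuit n) : Type := {s : Segment C // IsFree s}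

noncomputable instance {n : ℕ} (C : Circuit n) : Fintype (FreeVar C) := Fintype.ofFinite _

open Classical in
/-- Boundary pinning: the first segment of wire `a` is replaced by the input bit `y a`, the last
segment by the output bit `z a`, and free variables are kept. (On a wire without Hadamard gates
these two are one segment; the data are then only compatible if `y a = z a`.) -/
noncomputable def pin {n : ℕ} (C : Circuit n) (y z : Fin n → Bool) (s : Segment C) :
    MvPolynomial (FreeVar C) (ZMod 8) :=
  if h : IsFree s then MvPolynomial.X ⟨s, h⟩
  else if (s.2 : ℕ) = 0 then MvPolynomial.C ((y s.1).toNat : ZMod 8)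
  else MvPolynomial.C ((z s.1).toNat : ZMod 8)

/-- The pinned phase polynomial `f_C` of the amplitude `⟨z|C|y⟩`. -/
noncomputable def pinnedPhase {n : ℕ} (C : Circuit n) (y z : Fin n → Bool) :
    MvPolynomial (FreeVar C) (ZMod 8) :=
  MvPolynomial.bind₁ (pin C y z) (phasePolynomial C)

/-- The SOP variable graph of `⟨z|C|y⟩`: its vertices are the free segment variables, and its
edges are the pairs whose product occurs in the pinned phase polynomial modulo `8`. -/
noncomputable def sopGraph {n : ℕ} (C : Circuit n) (y z : Fin n → Bool) :
    SimpleGraph (FreeVar C) where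
  Adj u v := u ≠ v ∧
    (pinnedPhase C y z).coeff (Finsupp.single u 1 + Finsupp.single v 1) ≠ 0
  symm := ⟨fun u v h => ⟨h.1.symm, by rw [add_comm]; exact h.2⟩⟩
  loopless := ⟨fun _ h => h.1 rfl⟩

/-! ## The tensor network of a circuit -/

/-- The gates at positions `i < j` are consecutive gates on the wire of qubit `a`. -/
def ConsecutiveOn {n : ℕ} (C : Circuit n) (a : Fin n) (i j : Fin C.length) : Prop :=
  i < j ∧ a ∈ (C.get i).qubits ∧ a ∈ (C.get j).qubits ∧
    ∀ k, i < k → k < j → a ∉ (C.get k).qubits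

/-- The bond indices: the segments of wires that connect two consecutive gates. A bond is given by
its wire and the positions of the two gates. -/
abbrev Bond {n : ℕ} (C : Circuit n) : Type :=
  {b : Fin n × Fin C.length × Fin C.length // ConsecutiveOn C b.1 b.2.1 b.2.2}

/-- The tensor-network graph `N_C`, a multigraph: one vertex per gate and one edge per bond
index. -/
def tensorNetworkGraph {n : ℕ} (C : Circuit n) : Graph (Fin C.length) (Bond C) where
  vertexSet := Set.univ
  IsLink b i j := (i = b.1.2.1 ∧ j = b.1.2.2) ∨ (i = b.1.2.2 ∧ j = b.1.2.1)
  isLink_symm := fun _ _ => ⟨fun _ _ h => h.elim (fun h => .inr ⟨h.2, h.1⟩) fun h => .inl ⟨h.2, h.1⟩⟩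
  eq_or_eq_of_isLink_of_isLink := by
    rintro e x y v w (⟨rfl, rfl⟩ | ⟨rfl, rfl⟩) (⟨rfl, rfl⟩ | ⟨rfl, rfl⟩) <;> simp
  left_mem_of_isLink := fun _ _ _ _ => Set.mem_univ _

/-- The contraction complexity `cc(N_C)`: the treewidth of the line graph of `N_C`. -/
noncomputable def contractionComplexity {n : ℕ} (C : Circuit n) : ℤ :=
  treewidth (multigraphLineGraph (tensorNetworkGraph C))

/-! ## Bounds for the cut-rank -/

/-! The graph state circuit of a graph `G` on the qubits consists of a Hadamard layer, one CZ gate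
for every edge of `G`, and a second Hadamard layer. Each wire then carries exactly one free
variable, the Hadamard gates become linear terms after pinning, and the SOP graph is `G` itself. CZ
gates placed before the first Hadamard layer touch only pinned variables: the SOP graph does not see
them, but the tensor network does. This makes the two requirements independent of each other.

For the widths, `G` is a binomial tree. A binomial subtree is attached to the rest only through its
root, so the cuts given by the complete binary tree of words have cut-rank at most one
(`rankWidth_binomial_le`). Linear rank-width grows as path-width does on trees
(`exists_binomialCut`): three branches at the root each have, by induction, a cut of large rank. At
the middle one of the three thresholds, the root and the other two branches form a connected set
that meets both sides. It contains a crossing edge, which raises the rank by one.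

For the contraction complexity, the initial layer has a CZ gate for every pair of wires. The wires
are then the branch sets of a complete minor of the line graph, and the Helly property of subtrees
bounds the treewidth from below (`card_sub_one_le_treewidth`). -/

open Classical in
theorem le_cutRank {V : Type*} [Fintype V] {G : SimpleGraph V} {X : Set V} {k : ℕ}
    (f g : Fin k → V) (hf : ∀ i, f i ∈ X) (hg : ∀ i, g i ∉ X)
    (hdet : (Matrix.of fun i j => if G.Adj (f i) (g j) then (1 : ZMod 2) else 0).det ≠ 0) :
    k ≤ cutRank G X := by
  have hM : (Matrix.of fun i j => if G.Adj (f i) (g j) then (1 : ZMod 2) else 0) =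
      ((G.adjMatrix (ZMod 2)).submatrix (fun u : {v // v ∈ X} => (u : V))
        (fun w : {v // v ∉ X} => (w : V))).submatrix
        (fun i => ⟨f i, hf i⟩) (fun i => ⟨g i, hg i⟩) := by
    ext i j
    simp [SimpleGraph.adjMatrix_apply]
  have hrank := Matrix.rank_of_isUnit _
    ((Matrix.isUnit_iff_isUnit_det _).2 (isUnit_iff_ne_zero.2 hdet))
  rw [Fintype.card_fin, hM] at hrank
  exact hrank.symm.le.trans (Matrix.rank_submatrix_le _ _ _)

theorem cutRank_le_card {V : Type*} [Fintype V] (G : SimpleGraph V) (X : Set V) :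
    cutRank G X ≤ Fintype.card V := by
  classical
  exact (Matrix.rank_le_card_width _).trans (Fintype.card_subtype_le _)

/-- The cut-rank of a set is at most one if at most one vertex of the set has neighbours outside
of it. -/
theorem cutRank_le_one_of_left {V : Type*} [Fintype V] {G : SimpleGraph V} {X : Set V} (p : V)
    (h : ∀ u ∈ X, ∀ w ∉ X, G.Adj u w → u = p) : cutRank G X ≤ 1 := by
  classical
  by_cases hp : p ∈ X
  · refine (Matrix.rank_le_card_of_support_subset _ {⟨p, hp⟩} fun u hu => ?_).trans
      (Finset.card_singleton _).le
    obtain ⟨w, hw⟩ := Function.ne_iff.1 (Function.mem_support.1 hu)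
    have : G.Adj u w := by
      by_contra hn
      exact hw (by simp [Matrix.row, SimpleGraph.adjMatrix_apply, hn])
    simpa using Subtype.ext (h u u.2 w w.2 this)
  · refine (Matrix.rank_le_card_of_support_subset _ ∅ fun u hu => ?_).trans (by simp)
    obtain ⟨w, hw⟩ := Function.ne_iff.1 (Function.mem_support.1 hu)
    have : G.Adj u w := by
      by_contra hn
      exact hw (by simp [Matrix.row, SimpleGraph.adjMatrix_apply, hn])
    exact absurd (h u u.2 w w.2 this ▸ u.2) hp

theorem cutRank_le_one_of_right {V : Type*} [Fintype V] {G : SimpleGraph V} {X : Set V} (p : V)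
    (h : ∀ u ∈ X, ∀ w ∉ X, G.Adj u w → w = p) : cutRank G X ≤ 1 := by
  classical
  unfold cutRank
  rw [← Matrix.rank_transpose]
  have hs : Function.support ((G.adjMatrix (ZMod 2)).submatrix
      (fun u : {v // v ∈ X} => (u : V)) (fun w : {v // v ∉ X} => (w : V))).transpose.row ⊆
      {w | (w : V) = p} := fun w hw => by
    obtain ⟨u, hu⟩ := Function.ne_iff.1 (Function.mem_support.1 hw)
    have : G.Adj u w := by
      by_contra hn
      exact hu (by simp [Matrix.row, SimpleGraph.adjMatrix_apply, hn])
    exact h u u.2 w w.2 this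
  refine (Matrix.rank_le_card_of_support_subset _
    (Finset.univ.filter fun w : {v // v ∉ X} => (w : V) = p) fun w hw => by
    simpa using hs hw).trans ?_
  refine Finset.card_le_one.2 fun a ha b hb => ?_
  simp only [Finset.mem_filter, Finset.mem_univ, true_and] at ha hb
  exact Subtype.ext (ha.trans hb.symm)

/-! ## The complete binary tree -/

/-- The complete binary tree of depth `m`, whose nodes are the words of length at most `m`. -/
def binaryTree (m : ℕ) : SimpleGraph {l : List Bool // l.length ≤ m} where
  Adj x y := (∃ b, y.1 = x.1 ++ [b]) ∨ ∃ b, x.1 = y.1 ++ [b]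
  symm := ⟨fun _ _ h => h.symm⟩
  loopless := ⟨fun x h => by rcases h with ⟨b, h⟩ | ⟨b, h⟩ <;> simp at h⟩

/-- After deletion of the edge above the node `y`, the descendants of `y` form a component. -/
theorem binaryTree_prefix_iff_of_reachable {m : ℕ} {x y u v : {l : List Bool // l.length ≤ m}}
    {b : Bool} (hy : y.1 = x.1 ++ [b])
    (h : ((binaryTree m).deleteEdges {s(x, y)}).Reachable u v) : y.1 <+: u.1 ↔ y.1 <+: v.1 := by
  have step : ∀ (u v : {l : List Bool // l.length ≤ m}) (c : Bool), v.1 = u.1 ++ [c] →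
      s(u, v) ≠ s(x, y) → (y.1 <+: u.1 ↔ y.1 <+: v.1) := by
    intro u v c hv hne
    rw [hv, List.prefix_concat_iff]
    refine ⟨.inr, fun h => h.resolve_left fun h => hne ?_⟩
    obtain rfl : y = v := Subtype.ext (h.trans hv.symm)
    obtain rfl : x = u := Subtype.ext (List.append_inj_left' (hy.symm.trans hv) rfl)
    rfl
  obtain ⟨p⟩ := h
  induction p with
  | nil => rfl
  | cons h _ ih =>
    refine Iff.trans ?_ ih
    rw [SimpleGraph.deleteEdges_adj] at h
    rcases h with ⟨⟨c, h⟩ | ⟨c, h⟩, hne⟩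
    · exact step _ _ c h (by simpa using hne)
    · exact (step _ _ c h (by rw [Sym2.eq_swap]; simpa using hne)).symm

theorem binaryTree_reachable_of_prefix {m : ℕ} {x y : {l : List Bool // l.length ≤ m}} {b : Bool}
    (hy : y.1 = x.1 ++ [b]) (v : {l : List Bool // l.length ≤ m}) (hv : y.1 <+: v.1) :
    ((binaryTree m).deleteEdges {s(x, y)}).Reachable y v := by
  obtain ⟨v, hvm⟩ := v
  induction v using List.reverseRecOn with
  | nil => exact absurd (List.prefix_nil.1 hv) (by simp [hy])
  | append_singleton v c ih =>
    have hvm' : v.length ≤ m := by simp at hvm; omega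
    rcases List.prefix_concat_iff.1 hv with h | h
    · rw [show y = ⟨v ++ [c], hvm⟩ from Subtype.ext h]
    · refine (ih hvm' h).trans (SimpleGraph.Adj.reachable ?_)
      rw [SimpleGraph.deleteEdges_adj]
      refine ⟨.inl ⟨c, rfl⟩, fun he => ?_⟩
      have hlen := h.length_le
      have hylen : y.1.length = x.1.length + 1 := by simp [hy]
      rcases Sym2.eq_iff.1 (Set.mem_singleton_iff.1 he) with ⟨h1, h2⟩ | ⟨h1, h2⟩
      · have := congrArg (fun z => z.1.length) h1
        simp at this; omega
      · have := congrArg (fun z => z.1.length) h2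
        simp at this; omega

/-- The path from the root to `v` runs through the prefixes of `v`, so only the edges above these
prefixes have to survive. -/
theorem binaryTree_reachable_root {m : ℕ} (S : Set (Sym2 {l : List Bool // l.length ≤ m}))
    (v : {l : List Bool // l.length ≤ m})
    (hS : ∀ x y, y.1 <+: v.1 → (∃ b, y.1 = x.1 ++ [b]) → s(x, y) ∉ S) :
    ((binaryTree m).deleteEdges S).Reachable ⟨[], Nat.zero_le m⟩ v := by
  obtain ⟨v, hvm⟩ := v
  induction v using List.reverseRecOn with
  | nil => rfl
  | append_singleton v c ih =>
    have hvm' : v.length ≤ m := by simp at hvm; omega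
    refine (ih hvm' fun x y h => hS x y (h.trans (List.prefix_append _ _))).trans
      (SimpleGraph.Adj.reachable ?_)
    rw [SimpleGraph.deleteEdges_adj]
    exact ⟨.inl ⟨c, rfl⟩, hS _ _ (List.prefix_refl _) ⟨c, rfl⟩⟩

theorem binaryTree_not_reachable {m : ℕ} {x y : {l : List Bool // l.length ≤ m}} {b : Bool}
    (hy : y.1 = x.1 ++ [b]) : ¬ ((binaryTree m).deleteEdges {s(x, y)}).Reachable x y := fun h => by
  have := ((binaryTree_prefix_iff_of_reachable hy h).2 (List.prefix_refl _)).length_le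
  simp [hy] at this

theorem binaryTree_isTree (m : ℕ) : (binaryTree m).IsTree := by
  refine ⟨?_, ?_⟩
  · have : Nonempty {l : List Bool // l.length ≤ m} := ⟨⟨[], Nat.zero_le m⟩⟩
    refine ⟨fun u v => ?_⟩
    have h : ∀ v, (binaryTree m).Reachable ⟨[], Nat.zero_le m⟩ v := fun v => by
      simpa using binaryTree_reachable_root ∅ v (by simp)
    exact (h u).symm.trans (h v)
  · rw [SimpleGraph.isAcyclic_iff_forall_adj_isBridge]
    rintro x y (⟨b, h⟩ | ⟨b, h⟩)
    · exact binaryTree_not_reachable h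
    · rw [Sym2.eq_swap]
      exact binaryTree_not_reachable h

/-- Words without the prefix `y` all stay joined to the root, as the deleted edge is not on their
path from it. -/
theorem binaryTree_reachable_left_iff {m : ℕ} {x y : {l : List Bool // l.length ≤ m}} {b : Bool}
    (hy : y.1 = x.1 ++ [b]) (v : {l : List Bool // l.length ≤ m}) :
    ((binaryTree m).deleteEdges {s(x, y)}).Reachable x v ↔ ¬ y.1 <+: v.1 := by
  have hx : ¬ y.1 <+: x.1 := fun h => by have := h.length_le; simp [hy] at this
  refine ⟨fun h => by rwa [← binaryTree_prefix_iff_of_reachable hy h], fun hv => ?_⟩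
  have key : ∀ w : {l : List Bool // l.length ≤ m}, ¬ y.1 <+: w.1 →
      ((binaryTree m).deleteEdges {s(x, y)}).Reachable ⟨[], Nat.zero_le m⟩ w := fun w hw => by
    refine binaryTree_reachable_root _ w fun x' y' hp hb he => ?_
    rcases Sym2.eq_iff.1 (Set.mem_singleton_iff.1 he) with ⟨rfl, rfl⟩ | ⟨rfl, rfl⟩
    · exact hw hp
    · obtain ⟨c, hc⟩ := hb
      have := congrArg List.length hc
      simp [hy] at this
  exact (key x hx).symm.trans (key v hv)

theorem binaryTree_reachable_right_iff {m : ℕ} {x y : {l : List Bool // l.length ≤ m}} {b : Bool}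
    (hy : y.1 = x.1 ++ [b]) (v : {l : List Bool // l.length ≤ m}) :
    ((binaryTree m).deleteEdges {s(y, x)}).Reachable y v ↔ y.1 <+: v.1 := by
  rw [Sym2.eq_swap]
  exact ⟨fun h => (binaryTree_prefix_iff_of_reachable hy h).1 (List.prefix_refl _),
    binaryTree_reachable_of_prefix hy v⟩

theorem binaryTree_neighborSet_subset {m : ℕ} (x : {l : List Bool // l.length ≤ m}) :
    Subtype.val '' (binaryTree m).neighborSet x ⊆
      ({x.1 ++ [false], x.1 ++ [true], x.1.dropLast} : Set (List Bool)) := by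
  rintro _ ⟨y, ⟨b, hb⟩ | ⟨b, hb⟩, rfl⟩
  · cases b <;> simp [hb]
  · simp [hb]

theorem ncard_neighborSet_binaryTree_le {m : ℕ} (x : {l : List Bool // l.length ≤ m}) :
    ((binaryTree m).neighborSet x).ncard ≤ 3 := by
  rw [← Set.ncard_image_of_injective _ Subtype.val_injective]
  refine (Set.ncard_le_ncard (binaryTree_neighborSet_subset x)).trans ?_
  exact (Set.ncard_insert_le _ _).trans (by
    have := Set.ncard_insert_le (x.1 ++ [true]) {x.1.dropLast}
    rw [Set.ncard_singleton] at this
    omega)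

/-- Depth zero is excluded because a single node has no neighbour and so is not a leaf. -/
theorem isLeaf_binaryTree_iff {m : ℕ} (hm : m ≠ 0) (x : {l : List Bool // l.length ≤ m}) :
    IsLeaf (binaryTree m) x ↔ x.1.length = m := by
  refine ⟨fun h => ?_, fun h => ?_⟩
  · by_contra hx
    have hlt : ∀ b, (x.1 ++ [b]).length ≤ m := fun b => by
      have := x.2
      simp; omega
    obtain ⟨z, hz⟩ := Set.ncard_eq_one.1 h
    have hmem : ∀ b, (⟨x.1 ++ [b], hlt b⟩ : {l : List Bool // l.length ≤ m}) = z := fun b => by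
      have : (⟨x.1 ++ [b], hlt b⟩ : {l : List Bool // l.length ≤ m}) ∈
        (binaryTree m).neighborSet x := .inl ⟨b, rfl⟩
      rwa [hz] at this
    have := congrArg Subtype.val ((hmem false).trans (hmem true).symm)
    simp at this
  · obtain ⟨x, hxm⟩ := x
    rcases List.eq_nil_or_concat x with rfl | ⟨y, b, rfl⟩
    · exact absurd h.symm hm
    · have hy : y.length ≤ m := by simp at hxm; omega
      refine Set.ncard_eq_one.2 ⟨⟨y, hy⟩, Set.eq_singleton_iff_unique_mem.2
        ⟨.inr ⟨b, by simp⟩, ?_⟩⟩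
      rintro ⟨z, hz⟩ (⟨c, hc⟩ | ⟨c, hc⟩)
      · have := congrArg List.length hc
        simp at this h; omega
      · exact Subtype.ext (List.append_inj_left' (hc.symm.trans (List.concat_eq_append ..)) rfl)

/-- The complete binary tree as a rank-decomposition. -/
def binaryDecomposition {V : Type*} {m : ℕ} (hm : m ≠ 0)
    (e : V ≃ {l : List Bool // l.length = m}) : RankDecomposition V where
  Node := {l : List Bool // l.length ≤ m}
  finite_node := (List.finite_length_le Bool m).to_subtype
  tree := binaryTree m
  isTree := binaryTree_isTree m
  subcubic := ncard_neighborSet_binaryTree_le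
  leafEquiv :=
    { toFun := fun x => e.symm ⟨x.1.1, (isLeaf_binaryTree_iff hm x.1).1 x.2⟩
      invFun := fun v => ⟨⟨(e v).1, (e v).2.le⟩, (isLeaf_binaryTree_iff hm _).2 (e v).2⟩
      left_inv := fun x => by simp
      right_inv := fun v => by simp }

/-! ## Binomial trees -/

/-- Adjacency in the binomial tree, whose vertices are the words of a fixed length. The words with
a given prefix `l` induce a binomial tree with root `l ++ [false, …, false]`, and this tree arises
from those of `l ++ [false]` and `l ++ [true]` by joining their roots. -/
def BinomialAdj : List Bool → List Bool → Prop
  | a :: u, b :: v => (a = b ∧ BinomialAdj u v) ∨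
      (a ≠ b ∧ u = List.replicate u.length false ∧ v = List.replicate v.length false)
  | _, _ => False

theorem BinomialAdj.symm : ∀ {u v : List Bool}, BinomialAdj u v → BinomialAdj v u
  | _ :: _, _ :: _, .inl h => .inl ⟨h.1.symm, h.2.symm⟩
  | _ :: _, _ :: _, .inr h => .inr ⟨h.1.symm, h.2.2, h.2.1⟩

theorem BinomialAdj.irrefl {u : List Bool} : ¬ BinomialAdj u u := by
  induction u with
  | nil => simp [BinomialAdj]
  | cons a u ih => simp [BinomialAdj, ih]

theorem binomialAdj_append_left {l u v : List Bool} :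
    BinomialAdj (l ++ u) (l ++ v) ↔ BinomialAdj u v := by
  induction l with
  | nil => rfl
  | cons a l ih => simp [BinomialAdj, ih]

/-- The only vertex of a binomial subtree with neighbours outside of it is its root. -/
theorem BinomialAdj.eq_root {l u v : List Bool} (h : BinomialAdj (l ++ u) v) (hv : ¬ l <+: v) :
    u = List.replicate u.length false := by
  induction l generalizing v with
  | nil => simp at hv
  | cons a l ih =>
    cases v with
    | nil => simp [BinomialAdj] at h
    | cons b v =>
      rcases h with ⟨rfl, h⟩ | ⟨-, h, -⟩
      · exact ih h (by simpa [List.cons_prefix_cons] using hv)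
      · rw [List.eq_replicate_iff] at h ⊢
        exact ⟨rfl, fun b hb => h.2 b (by simp [hb])⟩

/-- A cut that separates some vertex of a binomial tree from the root has a crossing edge. -/
theorem exists_binomialAdj_of_mem (X : Set (List Bool)) (u : List Bool) (hu : u ∈ X)
    (hz : List.replicate u.length false ∉ X) :
    ∃ x y, x.length = u.length ∧ y.length = u.length ∧ x ∈ X ∧ y ∉ X ∧ BinomialAdj x y := by
  induction u generalizing X with
  | nil => exact absurd hu hz
  | cons a u ih =>
    -- Either the root of the half that contains the word lies in `X`, and the edge joining the
    -- roots of the two halves crosses, or the cut already separates the word from the root of its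
    -- half.
    by_cases ha : a :: List.replicate u.length false ∈ X
    · refine ⟨_, _, ?_, ?_, ha, hz, ?_⟩
      · simp
      · simp
      · cases a
        · exact absurd ha hz
        · simp [BinomialAdj, List.replicate_succ]
    · obtain ⟨x, y, hx, hy, hxX, hyX, h⟩ := ih ((a :: ·) ⁻¹' X) hu ha
      exact ⟨a :: x, a :: y, by simp [hx], by simp [hy], hxX, hyX, .inl ⟨rfl, h⟩⟩

theorem exists_binomialAdj_of_notMem (X : Set (List Bool)) (u : List Bool) (hu : u ∉ X)
    (hz : List.replicate u.length false ∈ X) :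
    ∃ x y, x.length = u.length ∧ y.length = u.length ∧ x ∈ X ∧ y ∉ X ∧ BinomialAdj x y := by
  obtain ⟨x, y, hx, hy, hxX, hyX, h⟩ := exists_binomialAdj_of_mem Xᶜ u hu (by simpa using hz)
  exact ⟨y, x, hy, hx, by simpa using hyX, hxX, h.symm⟩

/-- The prefixes of three binomial subtrees whose roots are adjacent to the root of the tree. -/
def branchPrefix : Fin 3 → List Bool :=
  ![[true, false, false], [false, true, false], [false, false, true]]

theorem length_branchPrefix (a : Fin 3) : (branchPrefix a).length = 3 := by
  fin_cases a <;> rfl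

/-- After the first letter in which two of the prefixes differ, one of them still contains a `true`,
whereas adjacency would require only `false` there. -/
theorem not_binomialAdj_branch {a b : Fin 3} (hab : a ≠ b) (u v : List Bool) :
    ¬ BinomialAdj (branchPrefix a ++ u) (branchPrefix b ++ v) := by
  fin_cases a <;> fin_cases b <;>
    simp [branchPrefix, BinomialAdj, List.replicate_succ] at hab ⊢

theorem binomialAdj_root_branch (a : Fin 3) (m : ℕ) :
    BinomialAdj (List.replicate (m + 3) false)
      (branchPrefix a ++ List.replicate m false) := by
  fin_cases a <;> simp [branchPrefix, BinomialAdj, List.replicate_succ]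

open Classical in
/-- The set `X` of words of length `m` cuts out a nonsingular matrix of order `k` from the
adjacency matrix of the binomial tree. -/
def BinomialCut (m k : ℕ) (X : Set (List Bool)) : Prop :=
  ∃ f g : Fin k → List Bool, (∀ i, (f i).length = m ∧ f i ∈ X) ∧
    (∀ i, (g i).length = m ∧ g i ∉ X) ∧
    (Matrix.of fun i j => if BinomialAdj (f i) (g j) then (1 : ZMod 2) else 0).det ≠ 0

/-- Extension of a cut in a branch by one crossing edge that is outside of this branch, and of
which one end is not adjacent to it. -/
theorem BinomialCut.succ {m k : ℕ} {X : Set (List Bool)} {l : List Bool}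
    (h : BinomialCut m k ((l ++ ·) ⁻¹' X)) {x y : List Bool} (hx : x.length = l.length + m)
    (hy : y.length = l.length + m) (hxX : x ∈ X) (hyX : y ∉ X) (hxy : BinomialAdj x y)
    (hl : (∀ u, ¬ BinomialAdj x (l ++ u)) ∨ ∀ u, ¬ BinomialAdj (l ++ u) y) :
    BinomialCut (l.length + m) (k + 1) X := by
  classical
  obtain ⟨f, g, hf, hg, hdet⟩ := h
  let F : Fin k ⊕ Fin 1 → List Bool := Sum.elim (fun i => l ++ f i) fun _ => x
  let G : Fin k ⊕ Fin 1 → List Bool := Sum.elim (fun i => l ++ g i) fun _ => y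
  refine ⟨F ∘ finSumFinEquiv.symm, G ∘ finSumFinEquiv.symm, fun i => ?_, fun i => ?_, ?_⟩
  · rcases h : finSumFinEquiv.symm i with j | j
    · simpa [F, h] using hf j
    · simp [F, h, hx, hxX]
  · rcases h : finSumFinEquiv.symm i with j | j
    · simpa [G, h] using hg j
    · simp [G, h, hy, hyX]
  · have hM : (Matrix.of fun i j => if BinomialAdj ((F ∘ finSumFinEquiv.symm) i)
          ((G ∘ finSumFinEquiv.symm) j) then (1 : ZMod 2) else 0) =
        (Matrix.of fun i j => if BinomialAdj (F i) (G j) then (1 : ZMod 2) else 0).submatrix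
          finSumFinEquiv.symm finSumFinEquiv.symm := rfl
    rw [hM, Matrix.det_submatrix_equiv_self,
      ← Matrix.fromBlocks_toBlocks (Matrix.of fun i j => if BinomialAdj (F i) (G j) then _ else _)]
    set M : Matrix (Fin k ⊕ Fin 1) (Fin k ⊕ Fin 1) (ZMod 2) :=
      Matrix.of fun i j => if BinomialAdj (F i) (G j) then 1 else 0
    have h11 : M.toBlocks₁₁ =
        Matrix.of fun i j => if BinomialAdj (f i) (g j) then (1 : ZMod 2) else 0 := by
      ext i j
      simp [M, F, G, Matrix.toBlocks₁₁, binomialAdj_append_left]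
    have h22 : M.toBlocks₂₂ = 1 := by
      ext i j
      obtain rfl := Subsingleton.elim i j
      simp [M, F, G, Matrix.toBlocks₂₂, hxy]
    -- One off-diagonal block vanishes, so the determinant is that of the branch.
    rcases hl with hl | hl
    · have : M.toBlocks₂₁ = 0 := by
        ext i j
        simp [M, F, G, Matrix.toBlocks₂₁, hl]
      rw [this, Matrix.det_fromBlocks_zero₂₁, h11, h22]
      simpa using hdet
    · have : M.toBlocks₁₂ = 0 := by
        ext i j
        simp [M, F, G, Matrix.toBlocks₁₂, hl]
      rw [this, Matrix.det_fromBlocks_zero₁₂, h11, h22]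
      simpa using hdet

/-- Every linear order of the vertices of a large binomial tree has an initial segment that cuts
out a large nonsingular matrix. -/
theorem exists_binomialCut (k : ℕ) (π : List Bool → ℕ)
    (hπ : Set.InjOn π {u | u.length = 3 * k + 1}) :
    ∃ i, BinomialCut (3 * k + 1) (k + 1) {u | π u < i} := by
  classical
  induction k generalizing π with
  | zero =>
    have key : ∀ b : Bool, π [b] < π [!b] → ∃ i, BinomialCut 1 1 {u | π u < i} := fun b hb =>
      ⟨π [!b], fun _ => [b], fun _ => [!b], by simpa using hb, by simp, by simp [BinomialAdj]⟩
    rcases lt_trichotomy (π [false]) (π [true]) with h | h | h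
    · exact key false h
    · exact absurd (hπ (by simp) (by simp) h) (by simp)
    · exact key true h
  | succ k ih =>
    have hcut : ∀ a, ∃ i, BinomialCut (3 * k + 1) (k + 1)
        ((branchPrefix a ++ ·) ⁻¹' {u | π u < i}) := fun a => by
      refine ih (fun u => π (branchPrefix a ++ u)) fun u hu v hv h => ?_
      exact List.append_cancel_left (hπ (by simp_all [length_branchPrefix]; ring)
        (by simp_all [length_branchPrefix]; ring) h)
    choose i hi using hcut
    -- `b` is the branch with the middle threshold. At `i b`, some vertex of branch `a` has been
    -- reached and some vertex of branch `c` has not.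
    have key : ∀ a b c : Fin 3, a ≠ b → c ≠ b → i a ≤ i b → i b ≤ i c →
        ∃ i, BinomialCut (3 * (k + 1) + 1) (k + 1 + 1) {u | π u < i} := by
      intro a b c hab hcb h1 h2
      set X : Set (List Bool) := {u | π u < i b} with hX
      set m := 3 * k + 1 with hm
      have hlen : (branchPrefix b).length + m = 3 * (k + 1) + 1 := by
        rw [length_branchPrefix]; ring
      refine ⟨i b, ?_⟩
      suffices ∃ x y : List Bool, x.length = m + 3 ∧ y.length = m + 3 ∧ x ∈ X ∧ y ∉ X ∧
          BinomialAdj x y ∧ ((∀ u, ¬ BinomialAdj x (branchPrefix b ++ u)) ∨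
            ∀ u, ¬ BinomialAdj (branchPrefix b ++ u) y) by
        obtain ⟨x, y, hx, hy, hxX, hyX, hxy, hl⟩ := this
        rw [← hlen]
        exact (hi b).succ (by rw [hx, length_branchPrefix, add_comm])
          (by rw [hy, length_branchPrefix, add_comm]) hxX hyX hxy hl
      -- Of the branches `a` and `c`, take one with a vertex on the side opposite to the root of the
      -- tree. A crossing edge lies inside it or joins its root to the root of the tree; an end in
      -- that branch is not adjacent to branch `b`.
      by_cases hr : List.replicate (m + 3) false ∈ X
      · obtain ⟨-, g, -, hg, -⟩ := hi c
        have hgX : branchPrefix c ++ g 0 ∉ X := by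
          have := (hg 0).2
          simp only [hX, Set.mem_preimage, Set.mem_ofPred_eq, not_lt] at this ⊢
          omega
        by_cases hR : branchPrefix c ++ List.replicate m false ∈ X
        · obtain ⟨x, y, hx, hy, hxX, hyX, hxy⟩ := exists_binomialAdj_of_notMem
            ((branchPrefix c ++ ·) ⁻¹' X) (g 0) hgX (by rw [(hg 0).1]; exact hR)
          exact ⟨_, _, by simp [length_branchPrefix, hx, (hg 0).1, add_comm],
            by simp [length_branchPrefix, hy, (hg 0).1, add_comm], hxX, hyX,
            binomialAdj_append_left.2 hxy, .inl fun u => not_binomialAdj_branch hcb _ _⟩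
        · exact ⟨_, _, by simp, by simp [length_branchPrefix, add_comm], hr, hR,
            binomialAdj_root_branch c m, .inr fun u => not_binomialAdj_branch hcb.symm _ _⟩
      · obtain ⟨f, -, hf, -, -⟩ := hi a
        have hfX : branchPrefix a ++ f 0 ∈ X := by
          have := (hf 0).2
          simp only [hX, Set.mem_preimage, Set.mem_ofPred_eq] at this ⊢
          omega
        by_cases hR : branchPrefix a ++ List.replicate m false ∈ X
        · exact ⟨_, _, by simp [length_branchPrefix, add_comm], by simp, hR, hr,
            (binomialAdj_root_branch a m).symm, .inl fun u => not_binomialAdj_branch hab _ _⟩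
        · obtain ⟨x, y, hx, hy, hxX, hyX, hxy⟩ := exists_binomialAdj_of_mem
            ((branchPrefix a ++ ·) ⁻¹' X) (f 0) hfX (by rw [(hf 0).1]; exact hR)
          exact ⟨_, _, by simp [length_branchPrefix, hx, (hf 0).1, add_comm],
            by simp [length_branchPrefix, hy, (hf 0).1, add_comm], hxX, hyX,
            binomialAdj_append_left.2 hxy, .inl fun u => not_binomialAdj_branch hab _ _⟩
    rcases le_total (i 0) (i 1) with h01 | h01 <;> rcases le_total (i 1) (i 2) with h12 | h12 <;>
      rcases le_total (i 0) (i 2) with h02 | h02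
    · exact key 0 1 2 (by decide) (by decide) h01 h12
    · exact key 0 1 2 (by decide) (by decide) h01 h12
    · exact key 0 2 1 (by decide) (by decide) h02 h12
    · exact key 2 0 1 (by decide) (by decide) h02 h01
    · exact key 1 0 2 (by decide) (by decide) h01 h02
    · exact key 1 2 0 (by decide) (by decide) h12 h02
    · exact key 2 1 0 (by decide) (by decide) h12 h01
    · exact key 2 1 0 (by decide) (by decide) h12 h01

theorem le_linearRankWidth_binomial {V : Type*} [Fintype V] {G : SimpleGraph V} (k : ℕ)
    (e : V ≃ {l : List Bool // l.length = 3 * k + 1})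
    (hG : ∀ u v, G.Adj u v ↔ BinomialAdj (e u) (e v)) : k + 1 ≤ linearRankWidth G := by
  classical
  -- An infimum over the empty set would be `0`, so some layout must be exhibited.
  refine le_csInf ⟨Fintype.card V, Fintype.equivFin V, fun i _ _ => cutRank_le_card G _⟩ ?_
  rintro w ⟨π, hw⟩
  -- The value at words of other lengths is irrelevant: only words of length `3 * k + 1` occur in
  -- the cut.
  let p : List Bool → ℕ := fun l => if h : l.length = 3 * k + 1 then π (e.symm ⟨l, h⟩) else 0
  obtain ⟨i, f, g, hf, hg, hdet⟩ := exists_binomialCut k p fun u hu v hv h => by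
    rw [Set.mem_ofPred_eq] at hu hv
    simpa [p, hu, hv, Fin.val_inj] using h
  have hfi : ∀ j, (π (e.symm ⟨f j, (hf j).1⟩) : ℕ) < i := fun j => by
    simpa [p, (hf j).1] using (hf j).2
  have hgi : ∀ j, ¬ (π (e.symm ⟨g j, (hg j).1⟩) : ℕ) < i := fun j => by
    simpa [p, (hg j).1] using (hg j).2
  -- The threshold is a proper one, since `f 0` lies before it and `g 0` does not.
  refine le_trans ?_ (hw i (by have := hfi 0; omega)
    (lt_of_le_of_lt (not_lt.1 (hgi 0)) (Fin.is_lt _)))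
  exact le_cutRank (fun j => e.symm ⟨f j, (hf j).1⟩) (fun j => e.symm ⟨g j, (hg j).1⟩) hfi hgi
    (by simpa [hG] using hdet)

/-- The words below a node `l` form a binomial subtree whose only vertex with outside neighbours is
`l` padded with `false`. Hence each cut matrix has at most one nonzero row or at most one nonzero
column. -/
theorem rankWidth_binomial_le {V : Type*} [Fintype V] {G : SimpleGraph V} {m : ℕ} (hm : m ≠ 0)
    (e : V ≃ {l : List Bool // l.length = m})
    (hG : ∀ u v, G.Adj u v ↔ BinomialAdj (e u) (e v)) : rankWidth G ≤ 1 := by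
  refine Nat.sInf_le ⟨binaryDecomposition hm e, fun x y hxy => ?_⟩
  have root : ∀ l : List Bool, l.length ≤ m → ∃ p : V, ∀ u v : V, l <+: (e u).1 →
      ¬ l <+: (e v).1 → G.Adj u v → u = p := fun l hl => by
    refine ⟨e.symm ⟨l ++ List.replicate (m - l.length) false, by simp [hl]⟩, fun u v hu hv h => ?_⟩
    obtain ⟨s, hs⟩ := hu
    have hlen := congrArg List.length hs
    rw [(e u).2, List.length_append] at hlen
    rw [hG, ← hs] at h
    rw [Equiv.eq_symm_apply]
    refine Subtype.ext (?_ : _ = l ++ List.replicate (m - l.length) false)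
    rw [← hs, show m - l.length = s.length by omega, ← h.eq_root hv]
  rcases hxy with ⟨b, hy⟩ | ⟨b, hx⟩
  · have hside : ∀ v, v ∈ (binaryDecomposition hm e).side x y ↔ ¬ y.1 <+: (e v).1 := fun v =>
      binaryTree_reachable_left_iff hy _
    obtain ⟨p, hp⟩ := root y.1 y.2
    refine cutRank_le_one_of_right p fun u hu w hw h => ?_
    rw [hside] at hu hw
    exact hp w u (not_not.1 hw) hu h.symm
  · have hside : ∀ v, v ∈ (binaryDecomposition hm e).side x y ↔ x.1 <+: (e v).1 := fun v =>
      binaryTree_reachable_right_iff hx _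
    obtain ⟨p, hp⟩ := root x.1 x.2
    refine cutRank_le_one_of_left p fun u hu w hw h => ?_
    rw [hside] at hu hw
    exact hp u w hu hw h

/-! ## Circuits whose variable graph is a given graph -/

/-- A layer of CZ gates, one for every edge of the graph `G`. -/
noncomputable def czLayer {n : ℕ} (G : SimpleGraph (Fin n)) : Circuit n :=
  open Classical in
  (Finset.univ : Finset {p : Fin n × Fin n // p.1 < p.2 ∧ G.Adj p.1 p.2}).toList.map
    fun p => .CZ p.1.1 p.1.2 p.2.1.ne

/-- A layer of Hadamard gates on all qubits. -/
def hadamardLayer (n : ℕ) : Circuit n := (List.finRange n).map .H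

/-- The circuit that prepares and measures the graph state of `G`, preceded by CZ gates between
all pairs of qubits. -/
noncomputable def graphStateCircuit {n : ℕ} (G : SimpleGraph (Fin n)) : Circuit n :=
  czLayer ⊤ ++ (hadamardLayer n ++ (czLayer G ++ hadamardLayer n))

theorem eq_CZ_of_mem_czLayer {n : ℕ} {G : SimpleGraph (Fin n)} {g : Gate n} (h : g ∈ czLayer G) :
    ∃ a b hab, g = .CZ a b hab := by
  obtain ⟨p, -, rfl⟩ := List.mem_map.1 h
  exact ⟨_, _, _, rfl⟩

theorem eq_H_of_mem_hadamardLayer {n : ℕ} {g : Gate n} (h : g ∈ hadamardLayer n) :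
    ∃ a, g = .H a := by
  obtain ⟨a, -, rfl⟩ := List.mem_map.1 h
  exact ⟨a, rfl⟩

theorem H_mem_hadamardLayer {n : ℕ} (a : Fin n) : .H a ∈ hadamardLayer n :=
  List.mem_map.2 ⟨a, List.mem_finRange a, rfl⟩

theorem exists_CZ_mem_czLayer_top {n : ℕ} {a b : Fin n} (hab : a ≠ b) :
    ∃ g ∈ czLayer (⊤ : SimpleGraph (Fin n)), a ∈ g.qubits ∧ b ∈ g.qubits := by
  rcases lt_or_gt_of_ne hab with h | h
  · exact ⟨.CZ a b hab, List.mem_map.2 ⟨⟨(a, b), h, hab⟩, by simp, rfl⟩, by simp [Gate.qubits]⟩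
  · exact ⟨.CZ b a hab.symm, List.mem_map.2 ⟨⟨(b, a), h, hab.symm⟩, by simp, rfl⟩,
      by simp [Gate.qubits]⟩

theorem graphStateCircuit_overHCZ {n : ℕ} (G : SimpleGraph (Fin n)) :
    (graphStateCircuit G).OverHCZ := by
  intro g hg a
  simp only [graphStateCircuit, List.mem_append] at hg
  rcases hg with h | h | h | h
  on_goal 1 => obtain ⟨_, _, _, rfl⟩ := eq_CZ_of_mem_czLayer h
  on_goal 2 => obtain ⟨_, rfl⟩ := eq_H_of_mem_hadamardLayer h
  on_goal 3 => obtain ⟨_, _, _, rfl⟩ := eq_CZ_of_mem_czLayer h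
  on_goal 4 => obtain ⟨_, rfl⟩ := eq_H_of_mem_hadamardLayer h
  all_goals simp

theorem hadamardDepth_append {n : ℕ} (C D : Circuit n) (a : Fin n) :
    hadamardDepth (C ++ D) a = hadamardDepth C a + hadamardDepth D a :=
  List.countP_append

theorem hadamardDepth_of_sublist_czLayer {n : ℕ} {G : SimpleGraph (Fin n)} {C : Circuit n}
    (h : C.Sublist (czLayer G)) (a : Fin n) : hadamardDepth C a = 0 := by
  refine List.countP_eq_zero.2 fun g hg => ?_
  obtain ⟨b, c, hbc, rfl⟩ := eq_CZ_of_mem_czLayer (h.subset hg)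
  simp [Gate.isHadamardOn]

theorem hadamardDepth_hadamardLayer {n : ℕ} (a : Fin n) : hadamardDepth (hadamardLayer n) a = 1 := by
  rw [hadamardDepth, hadamardLayer, List.countP_map,
    ← (List.nodup_iff_count_eq_one.1 (List.nodup_finRange n)) a (List.mem_finRange a), List.count]
  congr

theorem hadamardDepth_graphStateCircuit {n : ℕ} (G : SimpleGraph (Fin n)) (a : Fin n) :
    hadamardDepth (graphStateCircuit G) a = 2 := by
  simp [graphStateCircuit, hadamardDepth_append, hadamardDepth_hadamardLayer,
    hadamardDepth_of_sublist_czLayer (List.Sublist.refl _)]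

/-! ## Coefficients of the pinned phase polynomial -/

-- Pinned segments become constants, so a product with a pinned factor has degree below two and only
-- two free segments can produce the monomial.
open MvPolynomial in
open Classical in
theorem coeff_bind₁_pin {n : ℕ} (C : Circuit n) (y z : Fin n → Bool) (s s' : Segment C)
    (u v : FreeVar C) :
    (bind₁ (pin C y z) (4 * X s * X s')).coeff (Finsupp.single u 1 + Finsupp.single v 1) =
      if (s = u ∧ s' = v) ∨ (s = v ∧ s' = u) then 4 else 0 := by
  have hpin : ∀ s : Segment C, (∃ h : IsFree s, pin C y z s = monomial (.single ⟨s, h⟩ 1) 1) ∨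
      ¬ IsFree s ∧ ∃ c, pin C y z s = monomial 0 c := fun s => by
    by_cases h : IsFree s
    · exact .inl ⟨h, by simp [pin, h, X]⟩
    · refine .inr ⟨h, ?_⟩
      by_cases h0 : (s.2 : ℕ) = 0
      · exact ⟨_, by simp only [pin, h, h0, dif_neg, if_pos, not_false_eq_true]; rfl⟩
      · exact ⟨_, by simp only [pin, h, h0, dif_neg, if_neg, not_false_eq_true]; rfl⟩
  have h4 : (4 : MvPolynomial (FreeVar C) (ZMod 8)) = monomial 0 4 := rfl
  have hdeg : (Finsupp.single u 1 + Finsupp.single v 1).degree = 2 := by simp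
  rw [map_mul, map_mul, bind₁_X_right, bind₁_X_right, map_ofNat, h4]
  have hfree : ∀ (w : FreeVar C) (s : Segment C), ¬ IsFree s → s ≠ w := by
    rintro w _ h rfl
    exact h w.2
  rcases hpin s with ⟨h, hs⟩ | ⟨h, c, hs⟩ <;> rcases hpin s' with ⟨h', hs'⟩ | ⟨h', c', hs'⟩ <;>
    rw [hs, hs', monomial_mul, monomial_mul, coeff_monomial]
  · have := Finsupp.single_add_single_eq_single_add_single (k := (⟨s, h⟩ : FreeVar C))
      (l := ⟨s', h'⟩) (m := u) (n := v) (u := 1) (v := 1) one_ne_zero one_ne_zero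
    simp [this, Subtype.ext_iff]
  · rw [if_neg, if_neg]
    · simp [hfree _ _ h']
    · intro he
      rw [← he] at hdeg
      simp at hdeg
  · rw [if_neg, if_neg]
    · simp [hfree _ _ h]
    · intro he
      rw [← he] at hdeg
      simp at hdeg
  · rw [if_neg, if_neg]
    · simp [hfree _ _ h]
    · intro he
      rw [← he] at hdeg
      simp at hdeg

theorem segmentAfter_eq_iff {n : ℕ} {C : Circuit n} {i : ℕ} {a : Fin n} {s : Segment C} :
    segmentAfter C i a = s ↔ a = s.1 ∧ hadamardDepth (C.take i) a = s.2 := by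
  obtain ⟨b, k⟩ := s
  constructor
  · rintro h
    cases h
    exact ⟨rfl, rfl⟩
  · rintro ⟨rfl, h⟩
    simp only [segmentAfter]
    congr

theorem Segment.ext {n : ℕ} {C : Circuit n} {s s' : Segment C} (h : s.1 = s'.1)
    (h' : (s.2 : ℕ) = s'.2) : s = s' := by
  obtain ⟨a, k⟩ := s
  obtain ⟨b, l⟩ := s'
  obtain rfl : a = b := h
  obtain rfl : k = l := Fin.ext h'
  rfl

/-- The contribution of a gate, applied after the gates of `P`, to the coefficient of the product
of the middle variables of the wires `a` and `b`. -/
def czContribution {n : ℕ} (a b : Fin n) (P : Circuit n) : Gate n → ZMod 8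
  | .CZ c d _ => if ((c = a ∧ d = b) ∨ (c = b ∧ d = a)) ∧
      hadamardDepth P c = 1 ∧ hadamardDepth P d = 1 then 4 else 0
  | _ => 0

/-- The sum over the gates of a circuit of a function of the gate and of the gates before it. -/
def sumGates {n : ℕ} {M : Type*} [AddCommMonoid M] (F : Circuit n → Gate n → M) (C : Circuit n) :
    M :=
  ∑ i : Fin C.length, F (C.take i) (C.get i)

theorem sumGates_cons {n : ℕ} {M : Type*} [AddCommMonoid M] (F : Circuit n → Gate n → M)
    (g : Gate n) (C : Circuit n) :
    sumGates F (g :: C) = F [] g + sumGates (fun P => F (g :: P)) C :=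
  Fin.sum_univ_succ _

theorem sumGates_append {n : ℕ} {M : Type*} [AddCommMonoid M] (F : Circuit n → Gate n → M)
    (C D : Circuit n) :
    sumGates F (C ++ D) = sumGates F C + sumGates (fun P => F (C ++ P)) D := by
  induction C generalizing F with
  | nil => simp [sumGates]
  | cons g C ih => rw [List.cons_append, sumGates_cons, sumGates_cons, ih, add_assoc]; rfl

/-- The gates before a given gate form a sublist of the circuit, a condition that survives the
induction. -/
theorem sumGates_eq_sum_map {n : ℕ} {M : Type*} [AddCommMonoid M] {F : Circuit n → Gate n → M}
    {f : Gate n → M} {C : Circuit n} (h : ∀ P, P.Sublist C → ∀ g ∈ C, F P g = f g) :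
    sumGates F C = (C.map f).sum := by
  induction C generalizing F with
  | nil => rfl
  | cons g C ih =>
    rw [sumGates_cons, List.map_cons, List.sum_cons, h [] (List.nil_sublist _) g (by simp),
      ih fun P hP g' hg' => h _ (hP.cons_cons g) g' (by simp [hg'])]

/-- A Hadamard gate joins two segments of one wire, while distinct variables of index `1` lie on
different wires. Only CZ gates contribute. -/
theorem coeff_pinnedPhase {n : ℕ} (C : Circuit n) (y z : Fin n → Bool) {u v : FreeVar C}
    (hu : (u.1.2 : ℕ) = 1) (hv : (v.1.2 : ℕ) = 1) (huv : u ≠ v) (hT : C.OverHCZ) :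
    (pinnedPhase C y z).coeff (Finsupp.single u 1 + Finsupp.single v 1) =
      sumGates (czContribution u.1.1 v.1.1) C := by
  classical
  rw [pinnedPhase, phasePolynomial, map_sum, MvPolynomial.coeff_sum]
  refine Finset.sum_congr rfl fun i _ => ?_
  have hg : C.get i ∈ C := List.get_mem C i
  generalize C.get i = g at hg
  cases g with
  | H a =>
    rw [gatePhase, coeff_bind₁_pin]
    refine if_neg ?_
    rintro (⟨h1, h2⟩ | ⟨h1, h2⟩) <;> rw [segmentAfter_eq_iff] at h1 h2
    · exact huv (Subtype.ext (Segment.ext (h1.1.symm.trans h2.1) (hu.trans hv.symm)))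
    · exact huv (Subtype.ext (Segment.ext (h2.1.symm.trans h1.1) (hu.trans hv.symm)))
  | T a => exact absurd rfl (hT _ hg a)
  | CZ a b hab =>
    rw [gatePhase, coeff_bind₁_pin, czContribution]
    simp only [segmentAfter_eq_iff, hu, hv]
    congr 1
    exact propext (by tauto)

/-- Each edge is listed once, as an increasing pair, so at most one term is nonzero; two terms would
cancel modulo `8`. -/
theorem sum_czLayer {n : ℕ} {G : SimpleGraph (Fin n)} {a b : Fin n} (hab : a ≠ b) :
    ((czLayer G).map (czContribution a b (hadamardLayer n))).sum ≠ 0 ↔ G.Adj a b := by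
  classical
  have hsum : ((czLayer G).map (czContribution a b (hadamardLayer n))).sum =
      ∑ p : {p : Fin n × Fin n // p.1 < p.2 ∧ G.Adj p.1 p.2},
        if (p.1.1 = a ∧ p.1.2 = b) ∨ (p.1.1 = b ∧ p.1.2 = a) then (4 : ZMod 8) else 0 := by
    rw [czLayer, List.map_map, Finset.sum_map_toList]
    exact Finset.sum_congr rfl fun p _ => by
      simp [czContribution, hadamardDepth_hadamardLayer]
  rw [hsum]
  refine ⟨fun h => ?_, fun h => ?_⟩
  · obtain ⟨⟨⟨c, d⟩, hcd, hadj⟩, -, hp⟩ := Finset.exists_ne_zero_of_sum_ne_zero h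
    rcases (ite_ne_right_iff.1 hp).1 with ⟨rfl, rfl⟩ | ⟨rfl, rfl⟩
    · exact hadj
    · exact hadj.symm
  · suffices ∀ c d, (hcd : c < d ∧ G.Adj c d) → (c = a ∧ d = b) ∨ (c = b ∧ d = a) →
        (∑ p : {p : Fin n × Fin n // p.1 < p.2 ∧ G.Adj p.1 p.2},
          if (p.1.1 = a ∧ p.1.2 = b) ∨ (p.1.1 = b ∧ p.1.2 = a) then (4 : ZMod 8) else 0) ≠ 0 by
      rcases lt_or_gt_of_ne hab with hlt | hlt
      · exact this a b ⟨hlt, h⟩ (by simp)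
      · exact this b a ⟨hlt, h.symm⟩ (by simp)
    intro c d hcd hor
    rw [Finset.sum_eq_single ⟨(c, d), hcd⟩, if_pos hor]
    · decide
    · rintro ⟨⟨c', d'⟩, hlt, hadj⟩ _ hne
      refine if_neg fun h => hne (Subtype.ext (Prod.ext ?_ ?_)) <;> dsimp only at h hlt ⊢ <;> omega
    · simp

/-- The first CZ layer acts before any Hadamard gate, on segments of index `0`; in the second CZ
layer every wire has passed exactly one. -/
theorem sumGates_graphStateCircuit {n : ℕ} (G : SimpleGraph (Fin n)) (a b : Fin n) :
    sumGates (czContribution a b) (graphStateCircuit G) =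
      ((czLayer G).map (czContribution a b (hadamardLayer n))).sum := by
  have hH : ∀ P : Circuit n, ∀ g ∈ hadamardLayer n, czContribution a b P g = 0 := by
    intro P g hg
    obtain ⟨a, rfl⟩ := eq_H_of_mem_hadamardLayer hg
    rfl
  have hnil : ∀ {G : SimpleGraph (Fin n)} {P : Circuit n}, P.Sublist (czLayer G) → ∀ a,
      hadamardDepth P a = 0 := hadamardDepth_of_sublist_czLayer
  rw [graphStateCircuit, sumGates_append, sumGates_append, sumGates_append,
    sumGates_eq_sum_map (f := fun _ => 0) (C := czLayer ⊤),
    sumGates_eq_sum_map (f := fun _ => 0) (C := hadamardLayer n) fun P _ g hg => hH _ g hg,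
    sumGates_eq_sum_map (f := fun _ => 0) (C := hadamardLayer n) fun P _ g hg => hH _ g hg,
    sumGates_eq_sum_map (f := czContribution a b (hadamardLayer n)) (C := czLayer G)]
  · simp
  · intro P hP g hg
    obtain ⟨c, d, hcd, rfl⟩ := eq_CZ_of_mem_czLayer hg
    simp [czContribution, hadamardDepth_append, hnil hP, hnil (List.Sublist.refl _)]
  · intro P hP g hg
    obtain ⟨c, d, hcd, rfl⟩ := eq_CZ_of_mem_czLayer hg
    simp [czContribution, hnil hP]

theorem val_eq_one_of_graphStateCircuit {n : ℕ} {G : SimpleGraph (Fin n)}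
    (u : FreeVar (graphStateCircuit G)) : (u.1.2 : ℕ) = 1 := by
  have h0 := u.2.1
  have h2 := u.2.2
  have hlt := u.1.2.is_lt
  have h := hadamardDepth_graphStateCircuit G u.1.1
  omega

/-- The free variables of the graph state circuit correspond to the qubits. -/
noncomputable def graphStateCircuitEquiv {n : ℕ} (G : SimpleGraph (Fin n)) :
    FreeVar (graphStateCircuit G) ≃ Fin n := by
  refine Equiv.ofBijective (fun s => s.1.1) ⟨fun u v h => ?_, fun a => ?_⟩
  · exact Subtype.ext (Segment.ext h ((val_eq_one_of_graphStateCircuit u).trans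
      (val_eq_one_of_graphStateCircuit v).symm))
  · have h := hadamardDepth_graphStateCircuit G a
    refine ⟨⟨⟨a, ⟨1, by omega⟩⟩, one_ne_zero, ?_⟩, rfl⟩
    simp [h]

theorem sopGraph_graphStateCircuit_adj {n : ℕ} (G : SimpleGraph (Fin n)) (y z : Fin n → Bool)
    (u v : FreeVar (graphStateCircuit G)) :
    (sopGraph (graphStateCircuit G) y z).Adj u v ↔
      G.Adj (graphStateCircuitEquiv G u) (graphStateCircuitEquiv G v) := by
  by_cases huv : u = v
  · simp [huv]
  have hab : u.1.1 ≠ v.1.1 := fun h => huv ((graphStateCircuitEquiv G).injective h)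
  change u ≠ v ∧ _ ↔ G.Adj u.1.1 v.1.1
  rw [coeff_pinnedPhase _ y z (val_eq_one_of_graphStateCircuit u)
    (val_eq_one_of_graphStateCircuit v) huv (graphStateCircuit_overHCZ G),
    sumGates_graphStateCircuit, sum_czLayer hab]
  exact and_iff_right huv

/-! ## Helly property of subtrees, and treewidth of graphs with a clique minor -/

/-- A set of vertices that contains, with two vertices, all paths between them. -/
def IsPathConvex {N : Type*} (T : SimpleGraph N) (S : Set N) : Prop :=
  ∀ ⦃x y⦄, x ∈ S → y ∈ S → ∀ p : T.Walk x y, p.IsPath → ∀ z ∈ p.support, z ∈ S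

theorem IsPathConvex.inter {N : Type*} {T : SimpleGraph N} {A B : Set N} (hA : IsPathConvex T A)
    (hB : IsPathConvex T B) : IsPathConvex T (A ∩ B) :=
  fun _ _ hx hy p hp z hz => ⟨hA hx.1 hy.1 p hp z hz, hB hx.2 hy.2 p hp z hz⟩

/-- In a forest, a set is convex as soon as any two of its vertices are joined by a walk in it. -/
theorem SimpleGraph.IsAcyclic.isPathConvex {N : Type*} {T : SimpleGraph N} (hT : T.IsAcyclic)
    {S : Set N} (h : ∀ x ∈ S, ∀ y ∈ S, ∃ p : T.Walk x y, ∀ z ∈ p.support, z ∈ S) :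
    IsPathConvex T S := by
  classical
  intro x y hx hy p hp z hz
  obtain ⟨q, hq⟩ := h x hx y hy
  have : p = q.bypass := congrArg Subtype.val
    ((hT.subsingleton_path x y).elim ⟨p, hp⟩ ⟨q.bypass, q.bypass_isPath⟩)
  exact hq z (q.support_bypass_subset_support (this ▸ hz))

theorem exists_walk_support_subset {N : Type*} {T : SimpleGraph N} {S : Set N}
    (h : (T.induce S).Preconnected) {x y : N} (hx : x ∈ S) (hy : y ∈ S) :
    ∃ p : T.Walk x y, ∀ z ∈ p.support, z ∈ S := by
  obtain ⟨p⟩ := h ⟨x, hx⟩ ⟨y, hy⟩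
  refine ⟨p.map (SimpleGraph.Embedding.induce S).toHom, fun z hz => ?_⟩
  have hz' : z ∈ (p.map (SimpleGraph.Embedding.induce S).toHom).support := hz
  rw [SimpleGraph.Walk.support_map, List.mem_map] at hz'
  obtain ⟨w, -, rfl⟩ := hz'
  exact w.2

/-- The path from `A ∩ B` to `A ∩ C` lies in `A` and, since paths are unique, also inside a walk
through `B ∩ C` covered by `B ∪ C`. Where it leaves `B` it must already be in `C`. -/
theorem IsPathConvex.exists_mem_inter_inter {N : Type*} {T : SimpleGraph N} (hT : T.IsTree)
    {A B C : Set N} (hA : IsPathConvex T A) (hB : IsPathConvex T B) (hC : IsPathConvex T C)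
    (hAB : (A ∩ B).Nonempty) (hAC : (A ∩ C).Nonempty) (hBC : (B ∩ C).Nonempty) :
    (A ∩ B ∩ C).Nonempty := by
  classical
  obtain ⟨x, hxA, hxB⟩ := hAB
  obtain ⟨z, hzA, hzC⟩ := hAC
  obtain ⟨y, hyB, hyC⟩ := hBC
  have path : ∀ u v, ∃ p : T.Walk u v, p.IsPath := fun u v => by
    obtain ⟨p⟩ := hT.connected u v
    exact ⟨p.bypass, p.bypass_isPath⟩
  obtain ⟨p, hp⟩ := path x y
  obtain ⟨q, hq⟩ := path y z
  by_cases hzB : z ∈ B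
  · exact ⟨z, ⟨hzA, hzB⟩, hzC⟩
  have hr : ∀ w ∈ (p.append q).bypass.support, w ∈ A ∧ (w ∈ B ∨ w ∈ C) := fun w hw => by
    refine ⟨hA hxA hzA _ (SimpleGraph.Walk.bypass_isPath _) w hw, ?_⟩
    rcases (SimpleGraph.Walk.mem_support_append_iff _ _).1
      ((p.append q).support_bypass_subset_support hw) with h | h
    · exact .inl (hB hxB hyB p hp w h)
    · exact .inr (hC hyC hzC q hq w h)
  obtain ⟨d, hd, hdB, hdC⟩ := (p.append q).bypass.exists_boundary_dart B hxB hzB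
  have h1 := hr _ ((p.append q).bypass.dart_fst_mem_support_of_mem_darts hd)
  have h2 := hr _ ((p.append q).bypass.dart_snd_mem_support_of_mem_darts hd)
  by_cases hfC : d.fst ∈ C
  · exact ⟨d.fst, ⟨h1.1, hdB⟩, hfC⟩
  -- Otherwise the path in `C` from `d.snd` to `y` avoids `d.fst`. Prepending `d.fst` gives a path
  -- between points of `B`, which forces `d.snd` into `B`.
  obtain ⟨s, hs⟩ := path d.snd y
  have hcons : (SimpleGraph.Walk.cons d.adj s).IsPath := (SimpleGraph.Walk.cons_isPath_iff _ _).2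
    ⟨hs, fun h => hfC (hC (h2.2.resolve_left hdC) hyC s hs _ h)⟩
  exact absurd (hB hdB hyB _ hcons d.snd (by simp)) hdC

/-- The Helly property of subtrees of a tree. -/
theorem exists_forall_mem_of_isPathConvex {N ι : Type*} {T : SimpleGraph N} (hT : T.IsTree)
    (s : Finset ι) (A : ι → Set N) (hA : ∀ a, IsPathConvex T (A a))
    (h : ∀ a ∈ s, ∀ b ∈ s, (A a ∩ A b).Nonempty) : ∃ x, ∀ a ∈ s, x ∈ A a := by
  classical
  induction s using Finset.induction_on generalizing A with
  | empty => exact hT.connected.nonempty.elim fun x => ⟨x, by simp⟩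
  | insert b s hb ih =>
    rcases s.eq_empty_or_nonempty with rfl | ⟨c, hc⟩
    · obtain ⟨x, hx, -⟩ := h b (by simp) b (by simp)
      exact ⟨x, by simpa using hx⟩
    -- The traces on `A b` still meet pairwise, by the case of three sets.
    · obtain ⟨x, hx⟩ := ih (fun a => A a ∩ A b) (fun a => (hA a).inter (hA b))
        fun a ha a' ha' => by
          have := (hA a).exists_mem_inter_inter hT (hA a') (hA b)
            (h a (by simp [ha]) a' (by simp [ha'])) (h a (by simp [ha]) b (by simp))
            (h a' (by simp [ha']) b (by simp))
          refine this.mono ?_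
          rintro x ⟨⟨h1, h2⟩, h3⟩
          exact ⟨⟨h1, h3⟩, h2, h3⟩
      refine ⟨x, fun a ha => ?_⟩
      rcases Finset.mem_insert.1 ha with rfl | ha
      · exact (hx c hc).2
      · exact (hx a ha).1

/-- The nodes whose bags meet a connected set of vertices form a subtree. -/
theorem TreeDecomposition.isPathConvex_meet {V : Type*} {G : SimpleGraph V}
    (D : TreeDecomposition G) {B : Set V} (hB : (G.induce B).Preconnected) :
    IsPathConvex D.tree {i | ∃ v ∈ B, v ∈ D.bag i} := by
  have same : ∀ v ∈ B, ∀ i j, v ∈ D.bag i → v ∈ D.bag j →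
      ∃ p : D.tree.Walk i j, ∀ z ∈ p.support, ∃ v ∈ B, v ∈ D.bag z := fun v hv i j hi hj => by
    obtain ⟨p, hp⟩ := exists_walk_support_subset (D.connected_bags v).preconnected hi hj
    exact ⟨p, fun z hz => ⟨v, hv, hp z hz⟩⟩
  refine D.isTree.isAcyclic.isPathConvex ?_
  rintro i ⟨u, hu, hui⟩ j ⟨v, hv, hvj⟩
  obtain ⟨q⟩ := hB ⟨u, hu⟩ ⟨v, hv⟩
  suffices ∀ (u v : B), (G.induce B).Walk u v → ∀ i j, (u : V) ∈ D.bag i → (v : V) ∈ D.bag j →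
      ∃ p : D.tree.Walk i j, ∀ z ∈ p.support, ∃ v ∈ B, v ∈ D.bag z from
    this _ _ q i j hui hvj
  clear! i j u v
  intro u v q
  induction q with
  | nil => exact fun i j hi hj => same _ (Subtype.property _) i j hi hj
  | @cons u w v huw _ ih =>
    intro i j hi hj
    obtain ⟨k, hku, hkw⟩ := D.exists_edge_bag u w huw
    obtain ⟨p, hp⟩ := same u u.2 i k hi hku
    obtain ⟨p', hp'⟩ := ih k j hkw hj
    refine ⟨p.append p', fun z hz => ?_⟩
    exact ((SimpleGraph.Walk.mem_support_append_iff _ _).1 hz).elim (hp z) (hp' z)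

/-- By the Helly property one bag meets all branch sets, and disjointness makes the chosen vertices
distinct. -/
theorem TreeDecomposition.exists_card_le_card_bag {V ι : Type*} [Fintype ι] {G : SimpleGraph V}
    (D : TreeDecomposition G) (B : ι → Set V) (hdisj : Pairwise fun a b => Disjoint (B a) (B b))
    (hconn : ∀ a, (G.induce (B a)).Connected)
    (hadj : ∀ a b, a ≠ b → ∃ u ∈ B a, ∃ v ∈ B b, G.Adj u v) :
    ∃ i, Fintype.card ι ≤ (D.bag i).card := by
  classical
  obtain ⟨i, hi⟩ := exists_forall_mem_of_isPathConvex D.isTree Finset.univ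
    (fun a => {i | ∃ v ∈ B a, v ∈ D.bag i})
    (fun a => D.isPathConvex_meet (hconn a).preconnected) fun a _ b _ => by
      by_cases hab : a = b
      · subst hab
        obtain ⟨v⟩ := (hconn a).nonempty
        obtain ⟨i, hi⟩ := D.exists_mem_bag v
        exact ⟨i, ⟨v, v.2, hi⟩, v, v.2, hi⟩
      · obtain ⟨u, hu, v, hv, huv⟩ := hadj a b hab
        obtain ⟨i, hiu, hiv⟩ := D.exists_edge_bag u v huv
        exact ⟨i, ⟨u, hu, hiu⟩, v, hv, hiv⟩
  choose f hf hfi using fun a => hi a (Finset.mem_univ a)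
  refine ⟨i, ?_⟩
  rw [← Finset.card_univ]
  refine Finset.card_le_card_of_injOn f (fun a _ => hfi a) fun a _ b _ hab => ?_
  by_contra hne
  exact Set.disjoint_left.1 (hdisj hne) (hf a) (hab ▸ hf b)

/-- The decomposition with one bag. -/
def TreeDecomposition.trivial {V : Type*} [Fintype V] (G : SimpleGraph V) :
    TreeDecomposition G where
  Node := Unit
  finite_node := inferInstance
  tree := ⊥
  isTree := SimpleGraph.IsTree.of_subsingleton
  bag _ := Finset.univ
  exists_mem_bag v := ⟨(), Finset.mem_univ v⟩
  exists_edge_bag u v _ := ⟨(), Finset.mem_univ u, Finset.mem_univ v⟩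
  connected_bags v := by
    have : Nonempty {i : Unit | v ∈ (Finset.univ : Finset V)} := ⟨⟨(), Finset.mem_univ v⟩⟩
    have : Subsingleton {i : Unit | v ∈ (Finset.univ : Finset V)} := inferInstance
    exact ⟨fun x y => Subsingleton.elim x y ▸ SimpleGraph.Reachable.refl _⟩

/-- A graph with a complete minor on `k` vertices has treewidth at least `k - 1`. -/
theorem card_sub_one_le_treewidth {V ι : Type*} [Finite V] [Fintype ι] {G : SimpleGraph V}
    (B : ι → Set V) (hdisj : Pairwise fun a b => Disjoint (B a) (B b))
    (hconn : ∀ a, (G.induce (B a)).Connected)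
    (hadj : ∀ a b, a ≠ b → ∃ u ∈ B a, ∃ v ∈ B b, G.Adj u v) :
    (Fintype.card ι : ℤ) - 1 ≤ treewidth G := by
  have := Fintype.ofFinite V
  suffices Fintype.card ι ≤
      sInf {k : ℕ | ∃ D : TreeDecomposition G, ∀ i, (D.bag i).card ≤ k} by
    unfold treewidth
    omega
  refine le_csInf ⟨Fintype.card V, .trivial G, fun _ => Finset.card_le_univ _⟩ ?_
  rintro k ⟨D, hD⟩
  obtain ⟨i, hi⟩ := D.exists_card_le_card_bag B hdisj hconn hadj
  exact hi.trans (hD i)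

/-! ## Contraction complexity of graph state circuits -/

theorem exists_bond_of_lt {n : ℕ} {C : Circuit n} {a : Fin n} {i j : Fin C.length} (hij : i < j)
    (hi : a ∈ (C.get i).qubits) (hj : a ∈ (C.get j).qubits) :
    (∃ k, ConsecutiveOn C a i k) ∧ ∃ k, i ≤ k ∧ ConsecutiveOn C a k j := by
  classical
  constructor
  · obtain ⟨k, hk, hmin⟩ := Finset.exists_min_image
      (Finset.univ.filter fun k => i < k ∧ a ∈ (C.get k).qubits) id ⟨j, by simp [hij, -List.get_eq_getElem, hj]⟩
    simp only [Finset.mem_filter, Finset.mem_univ, true_and, id] at hk hmin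
    exact ⟨k, hk.1, hi, hk.2, fun l hil hlk hl => absurd (hmin l ⟨hil, hl⟩) (not_le.2 hlk)⟩
  · obtain ⟨k, hk, hmax⟩ := Finset.exists_max_image
      (Finset.univ.filter fun k => k < j ∧ a ∈ (C.get k).qubits) id ⟨i, by simp [hij, -List.get_eq_getElem, hi]⟩
    simp only [Finset.mem_filter, Finset.mem_univ, true_and, id] at hk hmax
    exact ⟨k, hmax i ⟨hij, hi⟩, hk.1, hk.2, hj,
      fun l hkl hlj hl => absurd (hmax l ⟨hlj, hl⟩) (not_le.2 hkl)⟩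

theorem mem_edgeSet_tensorNetworkGraph {n : ℕ} {C : Circuit n} (b : Bond C) :
    b ∈ (tensorNetworkGraph C).edgeSet :=
  ⟨b.1.2.1, b.1.2.2, .inl ⟨rfl, rfl⟩⟩

theorem tensorNetworkGraph_inc_left {n : ℕ} {C : Circuit n} (b : Bond C) :
    (tensorNetworkGraph C).Inc b b.1.2.1 :=
  ⟨b.1.2.2, .inl ⟨rfl, rfl⟩⟩

theorem tensorNetworkGraph_inc_right {n : ℕ} {C : Circuit n} (b : Bond C) :
    (tensorNetworkGraph C).Inc b b.1.2.2 :=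
  ⟨b.1.2.1, .inr ⟨rfl, rfl⟩⟩

/-- The bonds on the wire of the qubit `a`. -/
def wireBonds {n : ℕ} (C : Circuit n) (a : Fin n) : Set (tensorNetworkGraph C).edgeSet :=
  {b | b.1.1.1 = a}

/-- The bonds of a wire form a path. A bond that is not the earlier one has a predecessor ending at
its left gate, so induction on the right end of the later bond applies. -/
theorem preconnected_wireBonds {n : ℕ} (C : Circuit n) (a : Fin n) :
    ((multigraphLineGraph (tensorNetworkGraph C)).induce (wireBonds C a)).Preconnected := by
  have key : ∀ (N : ℕ) (e f : wireBonds C a), (f.1.1.1.2.2 : ℕ) = N → e.1.1.1.2.2 ≤ f.1.1.1.2.2 →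
      ((multigraphLineGraph (tensorNetworkGraph C)).induce (wireBonds C a)).Reachable e f := by
    intro N
    induction N using Nat.strong_induction_on with
    | _ N ih =>
      rintro ⟨⟨⟨⟨a', i, j⟩, he⟩, he'⟩, rfl⟩ ⟨⟨⟨⟨b, k, l⟩, hf⟩, hf'⟩, hb⟩ hN hjl
      obtain rfl : b = a' := hb
      dsimp only at hN hjl he hf
      rcases eq_or_lt_of_le hjl with rfl | hlt
      · have hik : i = k := by
          rcases lt_trichotomy i k with h | h | h
          · exact absurd hf.2.1 (he.2.2.2 k h hf.1)
          · exact h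
          · exact absurd he.2.1 (hf.2.2.2 i h he.1)
        subst hik
        rfl
      · have hjk : j ≤ k := not_lt.1 fun h => hf.2.2.2 j h hlt he.2.2.1
        obtain ⟨k', -, hk'⟩ := (exists_bond_of_lt (he.1.trans_le hjk) he.2.1 hf.2.1).2
        refine (ih k (hN ▸ hf.1) _ ⟨⟨⟨⟨b, k', k⟩, hk'⟩, mem_edgeSet_tensorNetworkGraph _⟩, rfl⟩
          rfl hjk).trans (SimpleGraph.Adj.reachable ⟨fun h => ?_, k, ?_, ?_⟩)
        · have : k = l := congrArg (fun e => e.1.1.2.2) h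
          exact absurd hf.1 (by simp [this])
        · exact tensorNetworkGraph_inc_right (C := C) ⟨⟨b, k', k⟩, hk'⟩
        · exact tensorNetworkGraph_inc_left (C := C) ⟨⟨b, k, l⟩, hf⟩
  intro e f
  rcases le_total e.1.1.1.2.2 f.1.1.1.2.2 with h | h
  · exact key _ e f rfl h
  · exact (key _ f e rfl h).symm

/-- If any two wires are joined by a gate that is the last one on neither of them, then the wires
form a complete minor of the line graph of the tensor network. -/
theorem card_sub_one_le_contractionComplexity {n : ℕ} {C : Circuit n} (hn : 2 ≤ n)
    (h : ∀ a b, a ≠ b → ∃ i j k : Fin C.length, i < j ∧ i < k ∧ a ∈ (C.get i).qubits ∧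
      b ∈ (C.get i).qubits ∧ a ∈ (C.get j).qubits ∧ b ∈ (C.get k).qubits) :
    (n : ℤ) - 1 ≤ contractionComplexity C := by
  have hadj : ∀ a b, a ≠ b → ∃ u ∈ wireBonds C a, ∃ v ∈ wireBonds C b,
      (multigraphLineGraph (tensorNetworkGraph C)).Adj u v := by
    intro a b hab
    obtain ⟨i, j, k, hij, hik, ha, hb, hj, hk⟩ := h a b hab
    obtain ⟨j, hj⟩ := (exists_bond_of_lt hij ha hj).1
    obtain ⟨k, hk⟩ := (exists_bond_of_lt hik hb hk).1
    refine ⟨⟨⟨⟨a, i, j⟩, hj⟩, mem_edgeSet_tensorNetworkGraph _⟩, rfl,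
      ⟨⟨⟨b, i, k⟩, hk⟩, mem_edgeSet_tensorNetworkGraph _⟩, rfl, fun he => hab ?_, i,
      tensorNetworkGraph_inc_left (C := C) ⟨⟨a, i, j⟩, hj⟩,
      tensorNetworkGraph_inc_left (C := C) ⟨⟨b, i, k⟩, hk⟩⟩
    exact congrArg (fun e => e.1.1.1) he
  have := card_sub_one_le_treewidth (wireBonds C)
    (fun a b hab => Set.disjoint_left.2 fun e ha hb => hab (ha.symm.trans hb))
    (fun a => by
      -- Connectedness includes nonemptiness: a second wire supplies a bond on wire `a`.
      have := Fin.nontrivial_iff_two_le.2 hn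
      obtain ⟨b, hb⟩ := exists_ne a
      obtain ⟨u, hu, -⟩ := hadj a b hb.symm
      have : Nonempty (wireBonds C a) := ⟨⟨u, hu⟩⟩
      exact ⟨preconnected_wireBonds C a⟩) hadj
  rwa [Fintype.card_fin] at this

/-- Any two wires meet in a CZ gate of the first layer, and the Hadamard layer after it ensures that
bonds leave this gate on both wires. -/
theorem le_contractionComplexity_graphStateCircuit {n : ℕ} (hn : 2 ≤ n)
    (G : SimpleGraph (Fin n)) : (n : ℤ) - 1 ≤ contractionComplexity (graphStateCircuit G) := by
  refine card_sub_one_le_contractionComplexity hn fun a b hab => ?_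
  obtain ⟨g, hg, hga, hgb⟩ := exists_CZ_mem_czLayer_top hab
  obtain ⟨i, hi, rfl⟩ := List.mem_iff_getElem.1 hg
  have later : ∀ a, ∃ j : Fin (graphStateCircuit G).length,
      (czLayer (⊤ : SimpleGraph (Fin n))).length ≤ j ∧ a ∈ ((graphStateCircuit G).get j).qubits := by
    intro a
    obtain ⟨j, hj, hja⟩ := List.mem_iff_getElem.1
      (List.mem_append_left (czLayer G ++ hadamardLayer n) (H_mem_hadamardLayer a))
    refine ⟨⟨(czLayer (⊤ : SimpleGraph (Fin n))).length + j, ?_⟩, Nat.le_add_right _ _, ?_⟩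
    · rw [graphStateCircuit, List.length_append]
      exact Nat.add_lt_add_left hj _
    · simp only [graphStateCircuit, List.get_eq_getElem]
      rw [List.getElem_append_right (Nat.le_add_right _ _)]
      simp only [Nat.add_sub_cancel_left, hja]
      simp [Gate.qubits]
  obtain ⟨j, hij, hj⟩ := later a
  obtain ⟨k, hik, hk⟩ := later b
  have hget : (graphStateCircuit G).get ⟨i, (hi.trans_le hij).trans j.2⟩ =
      (czLayer (⊤ : SimpleGraph (Fin n)))[i] := by
    simp only [graphStateCircuit, List.get_eq_getElem]
    exact List.getElem_append_left hi
  exact ⟨⟨i, (hi.trans_le hij).trans j.2⟩, j, k, hi.trans_le hij, hi.trans_le hik,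
    hget ▸ hga, hget ▸ hgb, hj, hk⟩

theorem mainTheorem4 :
    ∃ (K : ℕ) (c₁ c₂ : ℝ), 0 < c₁ ∧ 0 < c₂ ∧
      ∀ h t : ℕ, 1 ≤ t →
        ∃ (n : ℕ) (C : Circuit n), C.OverHCZ ∧
          (∀ y z : Fin n → Bool,
            rankWidth (sopGraph C y z) ≤ K ∧
            c₁ * (h : ℝ) ≤ (linearRankWidth (sopGraph C y z) : ℝ)) ∧
          c₂ * (t : ℝ) ≤ (contractionComplexity C : ℝ) := by
  refine ⟨1, 1, 1, one_pos, one_pos, fun h t ht => ?_⟩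
  -- This depth gives linear rank-width at least `h + t + 1`, and `2 ^ m` qubits give contraction
  -- complexity at least `2 ^ m - 1 ≥ m ≥ t`.
  set m := 3 * (h + t) + 1 with hm
  let e : Fin (2 ^ m) ≃ {l : List Bool // l.length = m} :=
    (Fintype.equivFinOfCardEq (α := List.Vector Bool m) (by simp)).symm
  let G : SimpleGraph (Fin (2 ^ m)) :=
    { Adj := fun a b => a ≠ b ∧ BinomialAdj (e a) (e b)
      symm := ⟨fun _ _ h => ⟨h.1.symm, h.2.symm⟩⟩
      loopless := ⟨fun _ h => h.1 rfl⟩ }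
  have hm2 : m + 1 ≤ 2 ^ m := Nat.lt_two_pow_self
  have hG : ∀ y z u v, (sopGraph (graphStateCircuit G) y z).Adj u v ↔
      BinomialAdj (((graphStateCircuitEquiv G).trans e) u)
        (((graphStateCircuitEquiv G).trans e) v) := fun y z u v => by
    rw [sopGraph_graphStateCircuit_adj]
    refine ⟨And.right, fun h => ⟨fun he => ?_, h⟩⟩
    simp only [Equiv.trans_apply, he] at h
    exact BinomialAdj.irrefl h
  refine ⟨2 ^ m, graphStateCircuit G, graphStateCircuit_overHCZ G, fun y z => ⟨?_, ?_⟩, ?_⟩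
  · exact rankWidth_binomial_le (Nat.succ_ne_zero _) _ (hG y z)
  · have := le_linearRankWidth_binomial (h + t) _ (hG y z)
    rw [one_mul]
    exact_mod_cast (by omega : h ≤ linearRankWidth (sopGraph (graphStateCircuit G) y z))
  · have h1 := le_contractionComplexity_graphStateCircuit (by omega) G
    have h2 : (t : ℤ) ≤ contractionComplexity (graphStateCircuit G) := by
      have : (m : ℤ) + 1 ≤ ((2 ^ m : ℕ) : ℤ) := by exact_mod_cast hm2
      omega
    rw [one_mul]
    exact_mod_cast h2
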